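/- Let $\mathcal X$ be a compact metric space (for instance a compact subset of a normed space), let $M$ be a real number, and fix a dominating measure $\mu$ on a measurable space $\mathcal Y$. For each $x\in\mathcal X$ let $p_{0x}$ be a probability density on $\mathcal Y$ with respect to $\mu$ (the true density of the response at covariate $x$), and write $E_x$ for expectation under $p_{0x}$. Let $\{f_t : t\in[-M,M]\}$ be a family of probability densities with respect to $\mu$, jointly measurable in $(t,y)$. Let $\Theta$ be a set of continuous functions $\mathcal X\to[-M,M]$ that is compact in the sup-norm metric $d(\theta_1,\theta_2)=\sup_{x\in\mathcal X}|\theta_1(x)-\theta_2(x)|$, and let $\Pi$ be a Borel probability measure (the prior) on $\Theta$. Let $x_1,x_2,\dots\in\mathcal X$ be design points and let $Y_1,Y_2,\dots$ be independent with $Y_i\sim p_{0x_i}$; their joint law is the product measure $P_0=p_{0x_1}\times p_{0x_2}\times\cdots$. The model is $Y_i\sim f_{\theta(x_i)}$ with $\theta\in\Theta$ unknown. Assume the following. 1. There is $\theta^*\in\Theta$ such that, for every $x\in\mathcal X$, $\theta^*(x)$ minimises the Kullback--Leibler divergence $E_x\log\frac{p_{0x}}{f_t}\in[0,\infty]$ over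 $t\in[-M,M]$, and $\theta^*$ lies in the sup-norm support of $\Pi$, i.e. $\Pi(\{\theta: d(\theta,\theta^*)<r\})>0$ for every $r>0$. 2. For all $x\in\mathcal X$ and $t\in[-M,M]$, $f_t>0$ holds $p_{0x}$-almost surely (so that the ratios below make sense). Moreover (a) $E_x\big[\log\frac{f_t}{f_{t'}}\big]$ and, for every $\alpha\in[0,1]$, $E_x\big[\big(\frac{f_t}{f_{t'}}\big)^\alpha\big]$ exist, are finite, and are continuous functions of $(x,t,t')\in\mathcal X\times[-M,M]^2$; (b) $E_x\big[\log^2\frac{f_t}{f_{t'}}\big]$ is finite and bounded on $\mathcal X\times[-M,M]^2$. 3. For every $\epsilon>0$ there is $\delta\in(0,1)$ such that for all $x\in\mathcal X$, $$\Big\{t\in[-M,M]: E_x\log\tfrac{f_{\theta^*(x)}}{f_t}<\delta\Big\}\subseteq\{t: |t-\theta^*(x)|<\epsilon\}.$$ 4. For every $x_0\in\mathcal X$ and $r>0$, $\displaystyle\liminf_{n\to\infty}\frac1n\sum_{i=1}^n \mathbf 1\{x_i\in B(x_0,r)\}>0$, where $B(x_0,r)$ is the open ball of radius $r$ about $x_0$.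 For a measurable set $A\subseteq\Theta$ let $$\Pi_n(A)=\frac{\int_A\prod_{i=1}^n\frac{f_{\theta(x_i)}(Y_i)}{f_{\theta^*(x_i)}(Y_i)}\,d\Pi(\theta)}{\int_\Theta\prod_{i=1}^n\frac{f_{\theta(x_i)}(Y_i)}{f_{\theta^*(x_i)}(Y_i)}\,d\Pi(\theta)}$$ be its posterior probability given $Y_1,\dots,Y_n$. Then for every $\epsilon>0$, $P_0$-almost surely the denominator of $\Pi_n$ lies in $(0,\infty)$ for all $n$, and $$\Pi_n\Big(\Big\{\theta\in\Theta:\ \sup_{x\in\mathcal X}|\theta(x)-\theta^*(x)|>\epsilon\Big\}\Big)\to 0 .$$ -/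

import Mathlib

open MeasureTheory Filter Topology Set
open scoped ENNReal

noncomputable section

namespace Misspecified

/-- A probability density on `𝒴` with respect to the dominating measure `μ`. -/
structure ProbDensity {𝒴 : Type*} [MeasurableSpace 𝒴] (μ : Measure 𝒴) where
  /-- the density as a real function -/
  toFun : 𝒴 → ℝ
  measurable : Measurable toFun
  nonneg : ∀ y, 0 ≤ toFun y
  lintegral_eq_one : ∫⁻ y, ENNReal.ofReal (toFun y) ∂μ = 1

instance {𝒴 : Type*} [MeasurableSpace 𝒴] {μ : Measure 𝒴} :
    CoeFun (ProbDensity μ) (fun _ => 𝒴 → ℝ) := ⟨ProbDensity.toFun⟩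

/-- The probability measure with the given density. -/
def ProbDensity.law {𝒴 : Type*} [MeasurableSpace 𝒴] {μ : Measure 𝒴} (g : ProbDensity μ) :
    Measure 𝒴 :=
  μ.withDensity (fun y => ENNReal.ofReal (g y))

instance {𝒴 : Type*} [MeasurableSpace 𝒴] {μ : Measure 𝒴} (g : ProbDensity μ) :
    IsProbabilityMeasure g.law :=
  ⟨by rw [ProbDensity.law, withDensity_apply _ MeasurableSet.univ, Measure.restrict_univ,
        g.lintegral_eq_one]⟩

section Model

variable {X : Type*} [MetricSpace X] [CompactSpace X]
  {𝒴 : Type*} [MeasurableSpace 𝒴] {μ : Measure 𝒴} {M : ℝ}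

/-- The expectation `E_x[h(Y)]`, where `Y` has density `p x`. -/
def expect (p : X → ProbDensity μ) (x : X) (h : 𝒴 → ℝ) : ℝ := ∫ y, h y ∂(p x).law

/-- At every `x`, the value `θstar x` minimises over `t ∈ [-M, M]` the Kullback-Leibler divergence
`E_x log (p x / f t)` (with values in `[0, ∞]`). -/
def IsPointwiseKLMinimizer (p : X → ProbDensity μ) (f : Icc (-M) M → ProbDensity μ)
    (θstar : C(X, Icc (-M) M)) : Prop :=
  ∀ x : X, ∀ t : Icc (-M) M,
    InformationTheory.klDiv (p x).law (f (θstar x)).law ≤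
      InformationTheory.klDiv (p x).law (f t).law

/-- Continuity of the expected log-likelihood ratios and of the expected powers of likelihood
ratios in `(x, t, t')`, and boundedness of the second moments of the log-likelihood ratios.
The finiteness of these expectations is part of the condition. -/
structure RatioConditions (p : X → ProbDensity μ) (f : Icc (-M) M → ProbDensity μ) : Prop where
  /-- the ratios `f t / f t'` and their logarithms make sense almost surely -/
  pos : ∀ (x : X) (t : Icc (-M) M), ∀ᵐ y ∂(p x).law, 0 < f t y
  integrable_log : ∀ (x : X) (t t' : Icc (-M) M),
    Integrable (fun y => Real.log (f t y / f t' y)) (p x).law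
  continuous_log : Continuous fun q : X × Icc (-M) M × Icc (-M) M =>
    expect p q.1 fun y => Real.log (f q.2.1 y / f q.2.2 y)
  integrable_rpow : ∀ α ∈ Icc (0 : ℝ) 1, ∀ (x : X) (t t' : Icc (-M) M),
    Integrable (fun y => (f t y / f t' y) ^ α) (p x).law
  continuous_rpow : ∀ α ∈ Icc (0 : ℝ) 1,
    Continuous fun q : X × Icc (-M) M × Icc (-M) M =>
      expect p q.1 fun y => (f q.2.1 y / f q.2.2 y) ^ α
  integrable_log_sq : ∀ (x : X) (t t' : Icc (-M) M),
    Integrable (fun y => Real.log (f t y / f t' y) ^ 2) (p x).law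
  bounded_log_sq : ∃ C : ℝ, ∀ (x : X) (t t' : Icc (-M) M),
    expect p x (fun y => Real.log (f t y / f t' y) ^ 2) ≤ C

/-- Kullback-Leibler neighbourhoods of `θstar x` are contained in Euclidean ones,
uniformly in `x`. -/
def UniformSeparation (p : X → ProbDensity μ) (f : Icc (-M) M → ProbDensity μ)
    (θstar : C(X, Icc (-M) M)) : Prop :=
  ∀ ε : ℝ, 0 < ε → ∃ δ ∈ Ioo (0 : ℝ) 1, ∀ x : X,
    {t : Icc (-M) M | expect p x (fun y => Real.log (f (θstar x) y / f t y)) < δ} ⊆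
      {t : Icc (-M) M | |(t : ℝ) - (θstar x : ℝ)| < ε}

/-- Every ball of the covariate space has positive lower frequency among the design points. -/
def PositiveLowerFrequency (x : ℕ → X) : Prop :=
  ∀ (x₀ : X) (r : ℝ), 0 < r →
    0 < liminf (fun n : ℕ => (1 / (n : ℝ)) *
      ∑ i ∈ Finset.range n, (Metric.ball x₀ r).indicator (fun _ => (1 : ℝ)) (x i)) atTop

/-- The joint law of the independent responses `Y₀, Y₁, …`, where `Y i` has density `p (x i)`. -/
def responseLaw (p : X → ProbDensity μ) (x : ℕ → X) : Measure (ℕ → 𝒴) :=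
  Measure.infinitePi fun i => (p (x i)).law

/-- The integral over `A` of the likelihood ratio of the first `n` responses with respect to
the prior. -/
def ratioIntegral (f : Icc (-M) M → ProbDensity μ) (x : ℕ → X) (θstar : C(X, Icc (-M) M))
    {Θ : Set C(X, Icc (-M) M)} [MeasurableSpace Θ] (prior : Measure Θ) (y : ℕ → 𝒴) (n : ℕ)
    (A : Set Θ) : ℝ≥0∞ :=
  ∫⁻ θ in A, ∏ i ∈ Finset.range n,
    ENNReal.ofReal (f (θ.1 (x i)) (y i) / f (θstar (x i)) (y i)) ∂prior

/-- The posterior mass of `A` given the first `n` responses. -/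
def posterior (f : Icc (-M) M → ProbDensity μ) (x : ℕ → X) (θstar : C(X, Icc (-M) M))
    {Θ : Set C(X, Icc (-M) M)} [MeasurableSpace Θ] (prior : Measure Θ) (y : ℕ → 𝒴) (n : ℕ)
    (A : Set Θ) : ℝ≥0∞ :=
  ratioIntegral f x θstar prior y n A / ratioIntegral f x θstar prior y n univ

end Model

end Misspecified

end

/-! The set of `θ` at distance at least `ε` from `θstar` is compact, and having vanishing posterior
mass almost surely passes to subsets and finite unions. So it suffices to give each `θ₁ ≠ θstar` a
ball whose posterior mass vanishes. This follows if the numerator over the ball decays exponentially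
while the denominator decays more slowly than every exponential.

Numerator. Under misspecification the mean of `f_θ / f_θstar` may exceed 1, so moments of small
order `α` are used. Their first-order behaviour in `α` is `1 + α E log (f_θ₁ / f_θstar)`, uniformly
by Dini's theorem (`exists_rpow_le_add`), and the expected logarithm is never positive. The
numerator is a mixture over the ball, and `lintegral_rpow_mixture_prod_le` bounds its moment by
integrating out one coordinate at a time, the earlier factors acting as a weight on `θ`. A single
step is `lintegral_rpow_mixture_le`: write the ratio as `f_θ₁ / f_θstar` times `f_θ / f_θ₁`; on a
small ball the second factor is close to 1 in mean and costs arbitrarily little. Near some covariate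
the expected logarithm is bounded away from 0, and the design visits that neighbourhood with
positive frequency, so the per-step bounds multiply to an exponentially small quantity.

Denominator. By Cauchy-Schwarz its reciprocal is at most a constant times an integral of reciprocal
likelihood ratios over a ball around `θstar`; there each factor has mean at most `exp b`, with `b`
as small as desired. Summing expectations over `n` turns both bounds into almost sure limits. -/

namespace Misspecified

/-! ### Moments of mixtures of product likelihood ratios. -/

section Mixture

variable {𝒴 : Type*} [MeasurableSpace 𝒴] {Ω : Type*} [MeasurableSpace Ω]

/-- Under a product measure, the coordinate `n` can be integrated separately from the previous
ones. -/
theorem lintegral_infinitePi_succ {P : ℕ → Measure 𝒴} [∀ i, IsProbabilityMeasure (P i)] (n : ℕ)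
    {F : (Finset.range n → 𝒴) × 𝒴 → ℝ≥0∞} (hF : Measurable F) :
    ∫⁻ y, F ((Finset.range n).restrict y, y n) ∂Measure.infinitePi P =
      ∫⁻ y, ∫⁻ z, F ((Finset.range n).restrict y, z) ∂P n ∂Measure.infinitePi P := by
  have hind : ProbabilityTheory.iIndepFun (fun i (y : ℕ → 𝒴) => y i) (Measure.infinitePi P) :=
    ProbabilityTheory.iIndepFun_infinitePi (X := fun _ y => y) (fun _ => measurable_id)
  have h1 := hind.indepFun_finset (Finset.range n) {n} (by simp)
    (fun i => measurable_pi_apply i)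
  have h2 : ProbabilityTheory.IndepFun ((Finset.range n).restrict : (ℕ → 𝒴) → _)
      (fun y : ℕ → 𝒴 => y n) (Measure.infinitePi P) :=
    h1.comp (φ := id) (ψ := fun z : ({n} : Finset ℕ) → 𝒴 => z ⟨n, by simp⟩) measurable_id
      (measurable_pi_apply (⟨n, by simp⟩ : ({n} : Finset ℕ)))
  have hm1 : Measurable ((Finset.range n).restrict : (ℕ → 𝒴) → _) := by fun_prop
  have h3 := (ProbabilityTheory.indepFun_iff_map_prod_eq_prod_map_map
    hm1.aemeasurable (measurable_pi_apply n).aemeasurable).1 h2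
  rw [Measure.infinitePi_map_eval] at h3
  have : IsProbabilityMeasure (Measure.map ((Finset.range n).restrict : (ℕ → 𝒴) → _)
    (Measure.infinitePi P)) := Measure.isProbabilityMeasure_map hm1.aemeasurable
  rw [← lintegral_map (f := F) (g := fun y : ℕ → 𝒴 => ((Finset.range n).restrict y, y n)) hF
    (hm1.prodMk (measurable_pi_apply n)), h3, lintegral_prod _ hF.aemeasurable,
    lintegral_map hF.lintegral_prod_right' hm1]

/-- A bound for the moment of order `α` of one-step mixtures, uniform in the mixing weight, gives
a bound for the moments of mixtures of products. -/
theorem lintegral_rpow_mixture_prod_le {P : ℕ → Measure 𝒴} [∀ i, IsProbabilityMeasure (P i)]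
    {ν : Measure Ω} [SFinite ν] {α : ℝ} {s : ℕ → Ω → 𝒴 → ℝ≥0∞}
    (hs : ∀ i, Measurable fun q : Ω × 𝒴 => s i q.1 q.2) {ρ : ℕ → ℝ≥0∞}
    (hstep : ∀ i (h : Ω → ℝ≥0∞), Measurable h →
      ∫⁻ y, (∫⁻ θ, h θ * s i θ y ∂ν) ^ α ∂P i ≤ ρ i * (∫⁻ θ, h θ ∂ν) ^ α) (n : ℕ) :
    ∫⁻ y, (∫⁻ θ, ∏ i ∈ Finset.range n, s i θ (y i) ∂ν) ^ α ∂Measure.infinitePi P ≤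
      (∏ i ∈ Finset.range n, ρ i) * ν univ ^ α := by
  induction n with
  | zero => simp
  | succ n ih =>
    have hH : Measurable fun q : (Finset.range n → 𝒴) × Ω =>
        ∏ i : Finset.range n, s i q.2 (q.1 i) := by
      refine Finset.measurable_prod _ fun i _ => ?_
      exact (hs i).comp (measurable_snd.prodMk ((measurable_pi_apply i).comp measurable_fst))
    have hF : Measurable fun q : (Finset.range n → 𝒴) × 𝒴 =>
        (∫⁻ θ, (∏ i : Finset.range n, s i θ (q.1 i)) * s n θ q.2 ∂ν) ^ α := by
      refine Measurable.pow_const (Measurable.lintegral_prod_right' (f := fun r :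
        ((Finset.range n → 𝒴) × 𝒴) × Ω => (∏ i : Finset.range n, s i r.2 (r.1.1 i)) *
          s n r.2 r.1.2) ?_) _
      exact (hH.comp ((measurable_fst.comp measurable_fst).prodMk measurable_snd)).mul
        ((hs n).comp (measurable_snd.prodMk (measurable_snd.comp measurable_fst)))
    have hconv : ∀ (y : ℕ → 𝒴) (θ : Ω), ∏ i : Finset.range n,
        s i θ ((Finset.range n).restrict y i) = ∏ i ∈ Finset.range n, s i θ (y i) := fun y θ =>
      Finset.prod_coe_sort (Finset.range n) fun i => s i θ (y i)
    have key := lintegral_infinitePi_succ (P := P) n hF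
    simp only [hconv] at key
    simp only [Finset.prod_range_succ]
    rw [key]
    -- With the earlier coordinates frozen, their product is the weight `h` in `hstep`; uniformity
    -- in `h` is what lets the induction close.
    calc _ ≤ ∫⁻ y, ρ n * (∫⁻ θ, ∏ i ∈ Finset.range n, s i θ (y i) ∂ν) ^ α
            ∂Measure.infinitePi P := by
          refine lintegral_mono fun y => hstep n _ ?_
          exact Finset.measurable_prod _ fun i _ => (hs i).comp (measurable_id.prodMk measurable_const)
      _ = ρ n * ∫⁻ y, (∫⁻ θ, ∏ i ∈ Finset.range n, s i θ (y i) ∂ν) ^ α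
            ∂Measure.infinitePi P := by
          refine lintegral_const_mul _ (Measurable.pow_const ?_ _)
          refine Measurable.lintegral_prod_right' (f := fun r : (ℕ → 𝒴) × Ω =>
            ∏ i ∈ Finset.range n, s i r.2 (r.1 i)) ?_
          exact Finset.measurable_prod _ fun i _ =>
            (hs i).comp (measurable_snd.prodMk ((measurable_pi_apply i).comp measurable_fst))
      _ ≤ ρ n * ((∏ i ∈ Finset.range n, ρ i) * ν univ ^ α) := by gcongr
      _ = _ := by ring

/-- The first moment of a mixture of products. -/
theorem lintegral_mixture_prod_le {P : ℕ → Measure 𝒴} [∀ i, IsProbabilityMeasure (P i)]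
    {ν : Measure Ω} [SFinite ν] {s : ℕ → Ω → 𝒴 → ℝ≥0∞}
    (hs : ∀ i, Measurable fun q : Ω × 𝒴 => s i q.1 q.2) {ρ : ℕ → ℝ≥0∞}
    (hρ : ∀ i, ∀ᵐ θ ∂ν, ∫⁻ y, s i θ y ∂P i ≤ ρ i) (n : ℕ) :
    ∫⁻ y, ∫⁻ θ, ∏ i ∈ Finset.range n, s i θ (y i) ∂ν ∂Measure.infinitePi P ≤
      (∏ i ∈ Finset.range n, ρ i) * ν univ := by
  have := lintegral_rpow_mixture_prod_le (P := P) (ν := ν) (α := 1) hs (ρ := ρ) ?_ n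
  · simpa using this
  intro i h hh
  simp only [ENNReal.rpow_one]
  rw [lintegral_lintegral_swap (by
    exact ((hh.comp measurable_snd).mul ((hs i).comp measurable_swap)).aemeasurable),
    ← lintegral_const_mul _ hh]
  refine lintegral_mono_ae ((hρ i).mono fun θ hθ => ?_)
  rw [lintegral_const_mul _ (f := fun y => s i θ y)
    ((hs i).comp (measurable_const.prodMk measurable_id)), mul_comm]
  gcongr

/-- The moment of order `α ≤ 1 / 2` of a mixture whose components, relative to a reference
component, are close to `1` in mean. -/
theorem lintegral_rpow_mixture_le {P : Measure 𝒴} [IsProbabilityMeasure P]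
    {ν : Measure Ω} [SFinite ν] {α : ℝ} (hα : 0 < α) (hα' : 2 * α ≤ 1)
    {s u : Ω → 𝒴 → ℝ≥0∞} {w : 𝒴 → ℝ≥0∞} {d : Ω → 𝒴 → ℝ≥0∞}
    (hu : Measurable fun q : Ω × 𝒴 => u q.1 q.2) (hw : Measurable w)
    (hd : Measurable fun q : Ω × 𝒴 => d q.1 q.2)
    (hsuw : ∀ᵐ y ∂P, ∀ θ, s θ y = w y * u θ y) (hud : ∀ θ y, u θ y ≤ 1 + d θ y)
    {η : ℝ≥0∞} (hη : ∀ᵐ θ ∂ν, ∫⁻ y, d θ y ∂P ≤ η) {h : Ω → ℝ≥0∞} (hh : Measurable h) :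
    ∫⁻ y, (∫⁻ θ, h θ * s θ y ∂ν) ^ α ∂P ≤
      (∫⁻ y, w y ^ α ∂P + η ^ α * (∫⁻ y, w y ^ (2 * α) ∂P) ^ (1 / 2 : ℝ)) *
        (∫⁻ θ, h θ ∂ν) ^ α := by
  set m := ∫⁻ θ, h θ ∂ν with hm
  set D : 𝒴 → ℝ≥0∞ := fun y => ∫⁻ θ, h θ * d θ y ∂ν with hD
  have hhd : Measurable fun r : 𝒴 × Ω => h r.2 * d r.2 r.1 :=
    (hh.comp measurable_snd).mul (hd.comp measurable_swap)
  have hDm : Measurable D := Measurable.lintegral_prod_right' hhd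
  have hDint : ∫⁻ y, D y ∂P ≤ η * m := by
    rw [hD, lintegral_lintegral_swap hhd.aemeasurable, hm, ← lintegral_const_mul _ hh]
    refine lintegral_mono_ae (hη.mono fun θ hθ => ?_)
    rw [lintegral_const_mul _ (f := fun y => d θ y)
      (hd.comp (measurable_const.prodMk measurable_id)), mul_comm]
    gcongr
  have hpt : ∀ᵐ y ∂P, (∫⁻ θ, h θ * s θ y ∂ν) ^ α ≤ m ^ α * w y ^ α + w y ^ α * D y ^ α := by
    filter_upwards [hsuw] with y hy
    have h1 : ∫⁻ θ, h θ * s θ y ∂ν = w y * ∫⁻ θ, h θ * u θ y ∂ν := by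
      rw [← lintegral_const_mul _ (f := fun θ => h θ * u θ y) (hh.mul (hu.comp (measurable_id.prodMk measurable_const)))]
      refine lintegral_congr fun θ => ?_
      rw [hy]; ring
    have h2 : ∫⁻ θ, h θ * u θ y ∂ν ≤ m + D y := by
      rw [hm, hD, ← lintegral_add_left hh]
      refine lintegral_mono fun θ => ?_
      calc h θ * u θ y ≤ h θ * (1 + d θ y) := by gcongr; exact hud θ y
        _ = _ := by ring
    rw [h1, ENNReal.mul_rpow_of_nonneg _ _ hα.le]
    calc w y ^ α * (∫⁻ θ, h θ * u θ y ∂ν) ^ α ≤ w y ^ α * (m + D y) ^ α := by gcongr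
      _ ≤ w y ^ α * (m ^ α + D y ^ α) := by
        gcongr; exact ENNReal.rpow_add_le_add_rpow _ _ hα.le (by linarith)
      _ = _ := by ring
  -- Only the mean of `D` is controlled; since `2 * α ≤ 1` and `P` is a probability, it also
  -- controls the moment of order `2 * α` that Cauchy-Schwarz produces below.
  have hjensen : ∫⁻ y, D y ^ (2 * α) ∂P ≤ (η * m) ^ (2 * α) := by
    have h1 : eLpNorm D (ENNReal.ofReal (2 * α)) P ≤ eLpNorm D 1 P :=
      eLpNorm_le_eLpNorm_of_exponent_le (by
        rw [← ENNReal.ofReal_one]; exact ENNReal.ofReal_le_ofReal hα') hDm.aestronglyMeasurable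
    rw [eLpNorm_one_eq_lintegral_enorm, eLpNorm_eq_lintegral_rpow_enorm_toReal (by simpa using hα)
      ENNReal.ofReal_ne_top, ENNReal.toReal_ofReal (by linarith)] at h1
    simp only [enorm_eq_self] at h1
    rw [one_div, ENNReal.rpow_inv_le_iff (by linarith)] at h1
    exact h1.trans (by gcongr)
  have hholder : ∫⁻ y, w y ^ α * D y ^ α ∂P ≤
      (∫⁻ y, w y ^ (2 * α) ∂P) ^ (1 / 2 : ℝ) * (η * m) ^ α := by
    have := ENNReal.lintegral_mul_le_Lp_mul_Lq P (p := 2) (q := 2)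
      (by constructor <;> norm_num) (hw.pow_const α).aemeasurable (hDm.pow_const α).aemeasurable
    refine this.trans ?_
    simp only [← ENNReal.rpow_mul, mul_comm α 2]
    gcongr
    calc _ ≤ ((η * m) ^ (2 * α)) ^ (1 / 2 : ℝ) := by gcongr
      _ = _ := by rw [← ENNReal.rpow_mul]; ring_nf
  calc _ ≤ ∫⁻ y, m ^ α * w y ^ α + w y ^ α * D y ^ α ∂P := lintegral_mono_ae hpt
    _ = m ^ α * ∫⁻ y, w y ^ α ∂P + ∫⁻ y, w y ^ α * D y ^ α ∂P := by
      rw [lintegral_add_left ((hw.pow_const α).const_mul _),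
        lintegral_const_mul _ (hw.pow_const α)]
    _ ≤ m ^ α * ∫⁻ y, w y ^ α ∂P + (∫⁻ y, w y ^ (2 * α) ∂P) ^ (1 / 2 : ℝ) * (η * m) ^ α := by
      gcongr
    _ = _ := by rw [ENNReal.mul_rpow_of_nonneg _ _ hα.le]; ring

/-- A lower bound for an integral by means of the integral of the reciprocals. -/
theorem inv_lintegral_le {ν : Measure Ω} [IsFiniteMeasure ν] (hν : ν univ ≠ 0)
    {g k : Ω → ℝ≥0∞} (hg : Measurable g) (hk : Measurable k)
    (h1 : ∀ᵐ θ ∂ν, 1 ≤ g θ * k θ) :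
    (∫⁻ θ, g θ ∂ν)⁻¹ ≤ (ν univ)⁻¹ ^ 2 * ∫⁻ θ, k θ ∂ν := by
  set a := ∫⁻ θ, g θ ∂ν
  set b := ∫⁻ θ, k θ ∂ν
  rcases eq_or_ne a ∞ with hgi | hgi
  · simp [hgi]
  set m := ν univ with hm
  have hmt : m ≠ ∞ := measure_ne_top ν univ
  -- Cauchy-Schwarz for `g ^ (1/2)` and `k ^ (1/2)`, whose product is at least 1 almost everywhere.
  have hcs : m ≤ a ^ (1 / 2 : ℝ) * b ^ (1 / 2 : ℝ) := by
    have := ENNReal.lintegral_mul_le_Lp_mul_Lq ν (p := 2) (q := 2)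
      (by constructor <;> norm_num) (hg.pow_const (1 / 2 : ℝ)).aemeasurable
      (hk.pow_const (1 / 2 : ℝ)).aemeasurable
    simp only [← ENNReal.rpow_mul] at this
    norm_num at this
    norm_num
    refine le_trans ?_ this
    rw [hm, ← lintegral_one]
    refine lintegral_mono_ae (h1.mono fun θ hθ => ?_)
    rw [← ENNReal.mul_rpow_of_nonneg _ _ (by norm_num)]
    exact ENNReal.one_le_rpow hθ (by norm_num)
  have hcs2 : m ^ 2 ≤ a * b := by
    calc m ^ 2 ≤ (a ^ (1 / 2 : ℝ) * b ^ (1 / 2 : ℝ)) ^ 2 := by gcongr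
      _ = a * b := by
        rw [mul_pow, ← ENNReal.rpow_natCast, ← ENNReal.rpow_natCast, ← ENNReal.rpow_mul,
          ← ENNReal.rpow_mul]
        norm_num
  have ha : a ≠ 0 := by
    rintro h0
    rw [h0, zero_mul] at hcs2
    exact hν (by simpa using hcs2)
  have hm2 : (m⁻¹) ^ 2 * m ^ 2 = 1 := by
    rw [← mul_pow, ENNReal.inv_mul_cancel hν hmt, one_pow]
  calc a⁻¹ = a⁻¹ * ((m⁻¹) ^ 2 * m ^ 2) := by rw [hm2, mul_one]
    _ ≤ a⁻¹ * ((m⁻¹) ^ 2 * (a * b)) := by gcongr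
    _ = (a⁻¹ * a) * ((m⁻¹) ^ 2 * b) := by ring
    _ = _ := by rw [ENNReal.inv_mul_cancel ha hgi, one_mul]

end Mixture

/-! ### Uniform control of likelihood ratio moments by continuity and compactness. -/

section Moments

variable {X : Type*} [MetricSpace X]
  {𝒴 : Type*} [MeasurableSpace 𝒴] {μ : Measure 𝒴} {M : ℝ}
  {p : X → ProbDensity μ} {f : Icc (-M) M → ProbDensity μ}

theorem ratio_nonneg (f : Icc (-M) M → ProbDensity μ) (t t' : Icc (-M) M) (y : 𝒴) :
    0 ≤ f t y / f t' y :=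
  div_nonneg ((f t).nonneg y) ((f t').nonneg y)

/-- A strict upper bound for a continuous function on the diagonal persists near the diagonal. -/
theorem exists_forall_lt_of_diagonal [CompactSpace X] {T : Type*} [MetricSpace T] [CompactSpace T]
    {H : X × T × T → ℝ} (hH : Continuous H) {c : ℝ} (hc : ∀ z t, H (z, t, t) < c) :
    ∃ r > 0, ∀ z t t', dist t t' < r → H (z, t, t') < c := by
  have hK : IsCompact (range fun q : X × T => (q.1, q.2, q.2)) :=
    isCompact_range (by fun_prop)
  have hU : IsOpen {q | H q < c} := isOpen_lt hH continuous_const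
  obtain ⟨r, hr, hsub⟩ := hK.exists_thickening_subset_open hU (by
    rintro _ ⟨q, rfl⟩; exact hc q.1 q.2)
  refine ⟨r, hr, fun z t t' htt => hsub ?_⟩
  rw [Metric.mem_thickening_iff]
  exact ⟨(z, t', t'), ⟨(z, t'), rfl⟩, by simpa [Prod.dist_eq, hr] using htt⟩

theorem RatioConditions.lintegral_rpow (h : RatioConditions p f) {α : ℝ} (hα : α ∈ Icc (0 : ℝ) 1)
    (z : X) (t t' : Icc (-M) M) :
    ∫⁻ y, ENNReal.ofReal (f t y / f t' y) ^ α ∂(p z).law =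
      ENNReal.ofReal (expect p z fun y => (f t y / f t' y) ^ α) := by
  rw [expect, ofReal_integral_eq_lintegral_ofReal (h.integrable_rpow α hα z t t')
    (Eventually.of_forall fun y => Real.rpow_nonneg (ratio_nonneg f t t' y) α)]
  refine lintegral_congr fun y => ?_
  rw [ENNReal.ofReal_rpow_of_nonneg (ratio_nonneg f t t' y) hα.1]

theorem RatioConditions.lintegral_ratio (h : RatioConditions p f) (z : X) (t t' : Icc (-M) M) :
    ∫⁻ y, ENNReal.ofReal (f t y / f t' y) ∂(p z).law =
      ENNReal.ofReal (expect p z fun y => f t y / f t' y) := by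
  simpa using h.lintegral_rpow (α := 1) (by simp) z t t'

theorem RatioConditions.integrable_ratio (h : RatioConditions p f) (z : X) (t t' : Icc (-M) M) :
    Integrable (fun y => f t y / f t' y) (p z).law := by
  simpa using h.integrable_rpow 1 (by simp) z t t'

theorem RatioConditions.continuous_ratio (h : RatioConditions p f) :
    Continuous fun q : X × Icc (-M) M × Icc (-M) M =>
      expect p q.1 fun y => f q.2.1 y / f q.2.2 y := by
  simpa using h.continuous_rpow 1 (by simp)

theorem RatioConditions.expect_rpow_self (h : RatioConditions p f) (α : ℝ) (z : X)
    (t : Icc (-M) M) : expect p z (fun y => (f t y / f t y) ^ α) = 1 := by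
  have : (fun y => (f t y / f t y) ^ α) =ᵐ[(p z).law] fun _ => 1 := by
    filter_upwards [h.pos z t] with y hy
    rw [div_self hy.ne', Real.one_rpow]
  rw [expect, integral_congr_ae this]
  simp

theorem RatioConditions.expect_ratio_self (h : RatioConditions p f) (z : X) (t : Icc (-M) M) :
    expect p z (fun y => f t y / f t y) = 1 := by
  simpa using h.expect_rpow_self 1 z t

variable [CompactSpace X]

/-- The moments of a fixed order of the likelihood ratios are uniformly bounded. -/
theorem RatioConditions.exists_rpow_le (h : RatioConditions p f) {α : ℝ}
    (hα : α ∈ Icc (0 : ℝ) 1) : ∃ C : ℝ, 0 < C ∧ ∀ z t t',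
      expect p z (fun y => (f t y / f t' y) ^ α) ≤ C := by
  obtain ⟨C, hC⟩ := (isCompact_range (h.continuous_rpow α hα)).bddAbove
  exact ⟨max C 1, by positivity, fun z t t' => (hC ⟨(z, t, t'), rfl⟩).trans (le_max_left _ _)⟩

/-- Near the diagonal the expectation of the likelihood ratio is close to `1`. -/
theorem RatioConditions.exists_ratio_le (h : RatioConditions p f) {c : ℝ} (hc : 1 < c) :
    ∃ r > 0, ∀ z t t', dist t t' < r → expect p z (fun y => f t y / f t' y) < c :=
  exists_forall_lt_of_diagonal h.continuous_ratio fun z t => by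
    simpa [h.expect_ratio_self] using hc

/-- With `v = √u`, factor `|u - 1| = |v - 1| (v + 1)` and apply the weighted arithmetic-geometric
inequality. The bound involves only `u` and its square root, so its expectation is continuous in the
parameters by hypothesis, which is not assumed for the mean of `|u - 1|`. -/
theorem abs_sub_one_le {u l : ℝ} (hu : 0 ≤ u) (hl : 0 < l) :
    |u - 1| ≤ (u - 2 * u ^ (1 / 2 : ℝ) + 1) / (2 * l) + l * (u + 1) := by
  rw [← Real.sqrt_eq_rpow]
  have hs := Real.sq_sqrt hu
  have hs0 := Real.sqrt_nonneg u
  set v := √u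
  have h1 : |u - 1| = |v - 1| * (v + 1) := by
    rw [← hs, show v ^ 2 - 1 = (v - 1) * (v + 1) by ring, abs_mul, abs_of_nonneg (a := v + 1)
      (by linarith)]
  have h2 : u - 2 * v + 1 = |v - 1| ^ 2 := by rw [sq_abs, ← hs]; ring
  have h3 : (v + 1) ^ 2 / 2 ≤ u + 1 := by nlinarith [sq_nonneg (v - 1)]
  rw [h1, h2]
  have h4 : |v - 1| * (v + 1) ≤ |v - 1| ^ 2 / (2 * l) + l * ((v + 1) ^ 2 / 2) := by
    have : |v - 1| ^ 2 / (2 * l) + l * ((v + 1) ^ 2 / 2) - |v - 1| * (v + 1) =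
      (|v - 1| - l * (v + 1)) ^ 2 / (2 * l) := by field_simp; ring
    have : 0 ≤ (|v - 1| - l * (v + 1)) ^ 2 / (2 * l) := by positivity
    linarith
  exact h4.trans (by gcongr)

/-- Near the diagonal the likelihood ratios are close to `1` in mean. -/
theorem RatioConditions.exists_lintegral_abs_sub_one_le (h : RatioConditions p f) {η : ℝ}
    (hη : 0 < η) : ∃ r > 0, ∀ z t t', dist t t' < r →
      ∫⁻ y, ENNReal.ofReal |f t y / f t' y - 1| ∂(p z).law ≤ ENNReal.ofReal η := by
  -- On the diagonal the bound with weight `η / 4` equals `η / 2`, strictly below `η`.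
  have hl : 0 < η / 4 := by positivity
  have hhalf : (1 / 2 : ℝ) ∈ Icc (0 : ℝ) 1 := by constructor <;> norm_num
  obtain ⟨r, hr, H⟩ := exists_forall_lt_of_diagonal (X := X) (T := Icc (-M) M) (c := η)
    (H := fun q => (expect p q.1 (fun y => f q.2.1 y / f q.2.2 y) -
      2 * expect p q.1 (fun y => (f q.2.1 y / f q.2.2 y) ^ (1 / 2 : ℝ)) + 1) / (2 * (η / 4)) +
      η / 4 * (expect p q.1 (fun y => f q.2.1 y / f q.2.2 y) + 1))
    (by
      have h1 := h.continuous_ratio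
      have h2 := h.continuous_rpow _ hhalf
      exact (((h1.sub (h2.const_mul 2)).add continuous_const).div_const _).add
        ((h1.add continuous_const).const_mul _))
    (fun z t => by
      simp only [h.expect_ratio_self, h.expect_rpow_self]
      norm_num
      linarith)
  refine ⟨r, hr, fun z t t' htt => ?_⟩
  have hi1 := h.integrable_ratio z t t'
  have hi2 := h.integrable_rpow _ hhalf z t t'
  have hi0 : Integrable (fun y => f t y / f t' y - 2 * (f t y / f t' y) ^ (1 / 2 : ℝ))
    (p z).law := hi1.sub (hi2.const_mul 2)
  have hi3 : Integrable (fun y => f t y / f t' y - 2 * (f t y / f t' y) ^ (1 / 2 : ℝ) + 1)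
    (p z).law := hi0.add (integrable_const 1)
  have hi4 : Integrable (fun y => f t y / f t' y + 1) (p z).law := hi1.add (integrable_const 1)
  rw [← ofReal_integral_eq_lintegral_ofReal (f := fun y => |f t y / f t' y - 1|)
    (hi1.sub (integrable_const 1)).abs (Eventually.of_forall fun y => abs_nonneg _)]
  refine ENNReal.ofReal_le_ofReal (le_trans ?_ (H z t t' htt).le)
  calc _ ≤ ∫ y, ((f t y / f t' y - 2 * (f t y / f t' y) ^ (1 / 2 : ℝ) + 1) / (2 * (η / 4)) +
        η / 4 * (f t y / f t' y + 1)) ∂(p z).law :=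
        integral_mono (hi1.sub (integrable_const 1)).abs
          ((hi3.div_const _).add (hi4.const_mul _))
          fun y => abs_sub_one_le (ratio_nonneg f t t' y) hl
    _ = _ := by
      rw [integral_add (hi3.div_const _) (hi4.const_mul _), integral_div, integral_const_mul,
        integral_add hi0 (integrable_const 1),
        integral_sub hi1 (hi2.const_mul 2), integral_const_mul,
        integral_add hi1 (integrable_const 1)]
      simp [expect]

/-- The difference quotient at `0` of `α ↦ a ^ α` is monotone. -/
theorem rpow_sub_one_div_mono {a : ℝ} (ha : 0 < a) {α β : ℝ} (hα : 0 < α) (hαβ : α ≤ β) :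
    (a ^ α - 1) / α ≤ (a ^ β - 1) / β := by
  have hβ : 0 < β := hα.trans_le hαβ
  -- Bernoulli's inequality for `a ^ α = 1 + (a ^ α - 1)` raised to the power `β / α ≥ 1`.
  have h1 := one_add_mul_self_le_rpow_one_add (s := a ^ α - 1) (p := β / α)
    (by linarith [Real.rpow_nonneg ha.le α]) ((one_le_div hα).2 hαβ)
  rw [add_sub_cancel, ← Real.rpow_mul ha.le, mul_div_cancel₀ _ hα.ne'] at h1
  rw [le_div_iff₀ hβ]
  calc (a ^ α - 1) / α * β = β / α * (a ^ α - 1) := by ring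
    _ ≤ _ := by linarith

theorem log_le_rpow_sub_one_div {a α : ℝ} (ha : 0 < a) (hα : 0 < α) :
    Real.log a ≤ (a ^ α - 1) / α := by
  rw [le_div_iff₀ hα]
  have := Real.add_one_le_exp (Real.log a * α)
  rw [← Real.rpow_def_of_pos ha] at this
  linarith

theorem tendsto_rpow_sub_one_div {a : ℝ} (ha : 0 < a) :
    Tendsto (fun α : ℝ => (a ^ α - 1) / α) (𝓝[>] 0) (𝓝 (Real.log a)) := by
  have h := (Real.hasStrictDerivAt_const_rpow ha 0).hasDerivAt
  have h' := (hasDerivAt_iff_tendsto_slope.1 h).mono_left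
    (nhdsWithin_mono 0 (fun x (hx : x ∈ Ioi (0 : ℝ)) => (mem_Ioi.1 hx).ne'))
  simpa [slope_fun_def, div_eq_inv_mul] using h'

/-- The moments of small order of the likelihood ratios are, to first order and uniformly,
determined by the expected log-likelihood ratios. -/
theorem RatioConditions.exists_rpow_le_add (h : RatioConditions p f) {c : ℝ} (hc : 0 < c) :
    ∃ α : ℝ, 0 < α ∧ 2 * α ≤ 1 ∧ ∀ z t t',
      expect p z (fun y => (f t y / f t' y) ^ α) ≤
        1 + α * (expect p z (fun y => Real.log (f t y / f t' y)) + c) := by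
  -- The shift by 2 gives `2 * a k ≤ 1` already at `k = 0`.
  set a : ℕ → ℝ := fun k => 1 / ((k : ℝ) + 2) with ha
  have ha0 : ∀ k, 0 < a k := fun k => by positivity
  have ha1 : ∀ k, 2 * a k ≤ 1 := fun k => by
    rw [ha]; simp only; rw [← mul_div_assoc, div_le_one (by positivity)]
    have : (0 : ℝ) ≤ k := k.cast_nonneg
    linarith
  have ham : ∀ k, a k ∈ Icc (0 : ℝ) 1 := fun k => ⟨(ha0 k).le, by linarith [ha0 k, ha1 k]⟩
  have hanti : Antitone a := fun k l hkl => by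
    rw [ha]; simp only
    have : (k : ℝ) ≤ l := by exact_mod_cast hkl
    gcongr
  have hlim : Tendsto a atTop (𝓝[>] 0) := by
    refine tendsto_nhdsWithin_iff.2 ⟨?_, Eventually.of_forall ha0⟩
    have := (tendsto_natCast_atTop_atTop (R := ℝ)).atTop_add (tendsto_const_nhds (x := (2 : ℝ)))
    simpa [ha, Pi.inv_def] using this.inv_tendsto_atTop
  have hpos : ∀ z t t', ∀ᵐ y ∂(p z).law, 0 < f t y / f t' y := fun z t t' => by
    filter_upwards [h.pos z t, h.pos z t'] with y h1 h2 using div_pos h1 h2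
  have hint : ∀ k z t t', Integrable (fun y => ((f t y / f t' y) ^ a k - 1) / a k) (p z).law :=
    fun k z t t' => ((h.integrable_rpow _ (ham k) z t t').sub (integrable_const 1)).div_const _
  have heq : ∀ k z t t', (expect p z (fun y => (f t y / f t' y) ^ a k) - 1) / a k =
      ∫ y, ((f t y / f t' y) ^ a k - 1) / a k ∂(p z).law := fun k z t t' => by
    rw [integral_div, integral_sub (h.integrable_rpow _ (ham k) z t t') (integrable_const 1)]
    simp [expect]
  have hdini : TendstoUniformly
      (fun k (q : X × Icc (-M) M × Icc (-M) M) =>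
        (expect p q.1 (fun y => (f q.2.1 y / f q.2.2 y) ^ a k) - 1) / a k)
      (fun q => expect p q.1 fun y => Real.log (f q.2.1 y / f q.2.2 y)) atTop := by
    refine Antitone.tendstoUniformly_of_forall_tendsto
      (fun k => ((h.continuous_rpow _ (ham k)).sub continuous_const).div_const _) ?_
      h.continuous_log ?_
    · rintro k l hkl ⟨z, t, t'⟩
      simp only [heq]
      refine integral_mono_ae (hint _ _ _ _) (hint _ _ _ _) ?_
      filter_upwards [hpos z t t'] with y hy
      exact rpow_sub_one_div_mono hy (ha0 l) (hanti hkl)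
    · rintro ⟨z, t, t'⟩
      simp only [heq]
      -- By monotonicity each quotient lies between the logarithm and the quotient for `k = 0`, both
      -- integrable.
      refine tendsto_integral_of_dominated_convergence
        (fun y => |Real.log (f t y / f t' y)| + |((f t y / f t' y) ^ a 0 - 1) / a 0|)
        (fun k => (hint k z t t').aestronglyMeasurable)
        ((h.integrable_log z t t').abs.add (hint 0 z t t').abs) (fun k => ?_) ?_
      · filter_upwards [hpos z t t'] with y hy
        have h1 := log_le_rpow_sub_one_div hy (ha0 k)
        have h2 := rpow_sub_one_div_mono hy (ha0 k) (hanti (Nat.zero_le k))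
        rw [Real.norm_eq_abs, abs_le]
        constructor
        · linarith [neg_abs_le (Real.log (f t y / f t' y)),
            abs_nonneg (((f t y / f t' y) ^ a 0 - 1) / a 0)]
        · linarith [le_abs_self (((f t y / f t' y) ^ a 0 - 1) / a 0),
            abs_nonneg (Real.log (f t y / f t' y))]
      · filter_upwards [hpos z t t'] with y hy
        exact (tendsto_rpow_sub_one_div hy).comp hlim
  obtain ⟨k, hk⟩ := (Metric.tendstoUniformly_iff.1 hdini c hc).exists
  refine ⟨a k, ha0 k, ha1 k, fun z t t' => ?_⟩
  have := hk (z, t, t')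
  rw [dist_comm, Real.dist_eq] at this
  have := (abs_lt.1 this).2
  rw [sub_lt_iff_lt_add', div_lt_iff₀ (ha0 k)] at this
  linarith

end Moments

/-- Functions with exponentially decreasing integrals tend to zero almost everywhere. -/
theorem ae_tendsto_zero_of_lintegral_le_exp {Ω : Type*} [MeasurableSpace Ω] {P : Measure Ω}
    {Z : ℕ → Ω → ℝ≥0∞} (hZ : ∀ n, Measurable (Z n)) {C : ℝ≥0∞} (hC : C ≠ ∞) {β : ℝ} (hβ : 0 < β)
    (h : ∀ᶠ n : ℕ in atTop, ∫⁻ ω, Z n ω ∂P ≤ C * ENNReal.ofReal (Real.exp (-β * n))) :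
    ∀ᵐ ω ∂P, Tendsto (fun n => Z n ω) atTop (𝓝 0) := by
  obtain ⟨N, hN⟩ := eventually_atTop.1 h
  have hsum : ∑' n : ℕ, ENNReal.ofReal (Real.exp (-β * n)) ≠ ∞ := by
    have hs : Summable fun n : ℕ => Real.exp (-β * n) := by
      simpa [mul_comm] using Real.summable_exp_nat_mul_iff.2 (neg_lt_zero.2 hβ)
    exact hs.tsum_ofReal_ne_top
  have hfin : ∫⁻ ω, ∑' n : ℕ, Z (n + N) ω ∂P ≠ ∞ := by
    rw [lintegral_tsum fun n => (hZ _).aemeasurable]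
    refine ne_top_of_le_ne_top (ENNReal.mul_ne_top hC hsum) ?_
    rw [← ENNReal.tsum_mul_left]
    refine ENNReal.tsum_le_tsum fun n => (hN (n + N) (Nat.le_add_left _ _)).trans ?_
    gcongr C * ENNReal.ofReal (Real.exp ?_)
    push_cast
    have : (0 : ℝ) ≤ N := N.cast_nonneg
    nlinarith
  filter_upwards [ae_lt_top (Measurable.tsum fun n => hZ (n + N)) hfin] with ω hω
  exact (tendsto_add_atTop_iff_nat N).1 (ENNReal.tendsto_atTop_zero_of_tsum_ne_top hω.ne)

theorem expect_log_swap {X 𝒴 : Type*} [MeasurableSpace 𝒴] {μ : Measure 𝒴} {M : ℝ} (p : X → ProbDensity μ) (f : Icc (-M) M → ProbDensity μ) (z : X)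
    (t t' : Icc (-M) M) : expect p z (fun y => Real.log (f t y / f t' y)) =
      -expect p z fun y => Real.log (f t' y / f t y) := by
  rw [expect, expect, ← integral_neg]
  refine integral_congr_ae (Eventually.of_forall fun y => ?_)
  simp only
  rw [← Real.log_inv, inv_div]

/-! ### Separation, design frequencies and measurability. -/

section Posterior

variable {X : Type*} [MetricSpace X]
  {𝒴 : Type*} [MeasurableSpace 𝒴] {μ : Measure 𝒴} {M : ℝ}
  {p : X → ProbDensity μ} {f : Icc (-M) M → ProbDensity μ}

/-- Use the separation radius `|t - θstar z|` itself: a nonpositive expectation would be below `δ`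
and force `t` strictly closer to `θstar z` than it is. -/
theorem UniformSeparation.expect_log_pos {θstar : C(X, Icc (-M) M)}
    (h : UniformSeparation p f θstar) {z : X} {t : Icc (-M) M} (ht : t ≠ θstar z) :
    0 < expect p z fun y => Real.log (f (θstar z) y / f t y) := by
  have hpos : 0 < |(t : ℝ) - θstar z| :=
    abs_pos.2 (sub_ne_zero.2 fun heq => ht (Subtype.ext heq))
  obtain ⟨δ, hδ, H⟩ := h _ hpos
  by_contra hle
  have hlt : |(t : ℝ) - θstar z| < |(t : ℝ) - θstar z| :=
    H z (show _ < δ from (not_lt.1 hle).trans_lt hδ.1)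
  exact lt_irrefl _ hlt

theorem UniformSeparation.expect_log_nonneg {θstar : C(X, Icc (-M) M)}
    (h : UniformSeparation p f θstar) (z : X) (t : Icc (-M) M) :
    0 ≤ expect p z fun y => Real.log (f (θstar z) y / f t y) := by
  rcases eq_or_ne t (θstar z) with rfl | ht
  -- The integrand vanishes everywhere, also where the density is 0, because `0 / 0 = 0` and
  -- `Real.log 0 = 0`.
  · refine (integral_eq_zero_of_ae (Eventually.of_forall fun y => ?_)).ge
    rcases eq_or_ne ((f (θstar z)) y) 0 with h0 | h0 <;> simp [h0]
  · exact (h.expect_log_pos ht).le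

/-- The number of visits of a ball grows linearly. -/
theorem PositiveLowerFrequency.exists_le_sum {x : ℕ → X} (h : PositiveLowerFrequency x) (x₀ : X)
    {r : ℝ} (hr : 0 < r) : ∃ κ > 0, ∀ᶠ n : ℕ in atTop,
      κ * n ≤ ∑ i ∈ Finset.range n, (Metric.ball x₀ r).indicator (fun _ => (1 : ℝ)) (x i) := by
  have hL := h x₀ r hr
  refine ⟨_, half_pos hL, ?_⟩
  have hev := eventually_lt_of_lt_liminf (half_lt_self hL) (isBoundedUnder_of ⟨0, fun n =>
    mul_nonneg (by positivity) (Finset.sum_nonneg fun i _ =>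
      indicator_nonneg (fun _ _ => zero_le_one) _)⟩)
  filter_upwards [hev, eventually_gt_atTop 0] with n hn hn0
  have hn0' : (0 : ℝ) < n := by exact_mod_cast hn0
  rw [one_div, ← div_eq_inv_mul, lt_div_iff₀ hn0'] at hn
  exact hn.le

/-- A parameter other than `θstar` accumulates a linearly growing divergence from `θstar` along
the design points. -/
theorem RatioConditions.exists_le_sum_expect_log {x : ℕ → X} (h : RatioConditions p f)
    {θstar θ₁ : C(X, Icc (-M) M)} (hsep : UniformSeparation p f θstar)
    (hdesign : PositiveLowerFrequency x) (hne : θ₁ ≠ θstar) :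
    ∃ c > 0, ∀ᶠ n : ℕ in atTop, c * n ≤ ∑ i ∈ Finset.range n,
      expect p (x i) fun y => Real.log (f (θstar (x i)) y / f (θ₁ (x i)) y) := by
  obtain ⟨x₀, hx₀⟩ : ∃ z, θ₁ z ≠ θstar z := by
    by_contra! hall
    exact hne (ContinuousMap.ext hall)
  set K : X → ℝ := fun z => expect p z fun y => Real.log (f (θstar z) y / f (θ₁ z) y)
  have hpath : Continuous fun z : X => (z, θstar z, θ₁ z) := by fun_prop
  have hcomp := h.continuous_log.comp hpath
  have hKc : Continuous K := hcomp
  have hK0 : 0 < K x₀ := hsep.expect_log_pos hx₀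
  have hnear : ∀ᶠ z in 𝓝 x₀, K x₀ / 2 < K z :=
    hKc.continuousAt.eventually (lt_mem_nhds (half_lt_self hK0))
  obtain ⟨r', hr', hball⟩ := Metric.eventually_nhds_iff_ball.1 hnear
  obtain ⟨κ, hκ, hfreq⟩ := hdesign.exists_le_sum x₀ hr'
  refine ⟨K x₀ / 2 * κ, by positivity, hfreq.mono fun n hn => ?_⟩
  calc K x₀ / 2 * κ * n = K x₀ / 2 * (κ * n) := by ring
    _ ≤ K x₀ / 2 * ∑ i ∈ Finset.range n,
        (Metric.ball x₀ r').indicator (fun _ => (1 : ℝ)) (x i) := by gcongr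
    _ ≤ ∑ i ∈ Finset.range n, K (x i) := by
      rw [Finset.mul_sum]
      refine Finset.sum_le_sum fun i _ => ?_
      by_cases hi : x i ∈ Metric.ball x₀ r'
      · rw [indicator_of_mem hi, mul_one]
        exact (hball _ hi).le
      · rw [indicator_of_notMem hi, mul_zero]
        exact hsep.expect_log_nonneg (x i) (θ₁ (x i))

variable {Θ : Set C(X, Icc (-M) M)} [MeasurableSpace Θ] {prior : Measure Θ} {x : ℕ → X}

theorem tendsto_posterior_mono {θstar : C(X, Icc (-M) M)} {y : ℕ → 𝒴} {A B : Set Θ}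
    (hAB : A ⊆ B) (hB : Tendsto (fun n => posterior f x θstar prior y n B) atTop (𝓝 0)) :
    Tendsto (fun n => posterior f x θstar prior y n A) atTop (𝓝 0) :=
  tendsto_of_tendsto_of_tendsto_of_le_of_le tendsto_const_nhds hB (fun _ => zero_le)
    fun _ => ENNReal.div_le_div_right (lintegral_mono_set hAB) _

theorem tendsto_posterior_union {θstar : C(X, Icc (-M) M)} {y : ℕ → 𝒴} {A B : Set Θ}
    (hA : Tendsto (fun n => posterior f x θstar prior y n A) atTop (𝓝 0))
    (hB : Tendsto (fun n => posterior f x θstar prior y n B) atTop (𝓝 0)) :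
    Tendsto (fun n => posterior f x θstar prior y n (A ∪ B)) atTop (𝓝 0) := by
  refine tendsto_of_tendsto_of_tendsto_of_le_of_le tendsto_const_nhds (by simpa using hA.add hB)
    (fun _ => zero_le) fun n => ?_
  simp only [posterior]
  rw [← ENNReal.add_div]
  exact ENNReal.div_le_div_right (lintegral_union_le _ _ _) _

variable [BorelSpace Θ]

theorem measurable_density_eval (hf : Measurable fun q : Icc (-M) M × 𝒴 => f q.1 q.2) (z : X) :
    Measurable fun q : Θ × 𝒴 => f (q.1.1 z) q.2 := by
  have h1 : Measurable fun θ : Θ => θ.1 z :=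
    ((continuous_eval_const z).comp continuous_subtype_val).measurable
  exact hf.comp ((h1.comp measurable_fst).prodMk measurable_snd)

theorem measurable_ratio (hf : Measurable fun q : Icc (-M) M × 𝒴 => f q.1 q.2) (z : X)
    (t : Icc (-M) M) : Measurable fun q : Θ × 𝒴 => ENNReal.ofReal (f (q.1.1 z) q.2 / f t q.2) :=
  ((measurable_density_eval hf z).div ((f t).measurable.comp measurable_snd)).ennreal_ofReal

theorem measurable_ratio' (hf : Measurable fun q : Icc (-M) M × 𝒴 => f q.1 q.2) (z : X)
    (t : Icc (-M) M) : Measurable fun q : Θ × 𝒴 => ENNReal.ofReal (f t q.2 / f (q.1.1 z) q.2) :=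
  (((f t).measurable.comp measurable_snd).div (measurable_density_eval hf z)).ennreal_ofReal

theorem measurable_ratioIntegral [SFinite prior]
    (hf : Measurable fun q : Icc (-M) M × 𝒴 => f q.1 q.2) (θstar : C(X, Icc (-M) M)) (n : ℕ)
    (A : Set Θ) : Measurable fun y => ratioIntegral f x θstar prior y n A := by
  unfold ratioIntegral
  refine Measurable.lintegral_prod_right' (f := fun r : (ℕ → 𝒴) × Θ =>
    ∏ i ∈ Finset.range n,
      ENNReal.ofReal (f (r.2.1 (x i)) (r.1 i) / f (θstar (x i)) (r.1 i))) ?_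
  exact Finset.measurable_prod _ fun i _ => (measurable_ratio hf (x i) (θstar (x i))).comp
    (measurable_snd.prodMk ((measurable_pi_apply i).comp measurable_fst))

theorem RatioConditions.ae_pos (h : RatioConditions p f) (x : ℕ → X) (t : ℕ → Icc (-M) M) :
    ∀ᵐ y ∂responseLaw p x, ∀ i, 0 < f (t i) (y i) := by
  refine ae_all_iff.2 fun i => ?_
  have hq : Measure.QuasiMeasurePreserving (fun y : ℕ → 𝒴 => y i) (responseLaw p x)
    (p (x i)).law :=
    (measurePreserving_eval_infinitePi (fun i => (p (x i)).law) i).quasiMeasurePreserving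
  exact hq.ae (h.pos (x i) (t i))

/-- For each fixed `θ` positivity holds for almost every `y`; Fubini exchanges the two
almost-everywhere quantifiers. -/
theorem RatioConditions.ae_ae_pos [IsProbabilityMeasure prior]
    (h : RatioConditions p f) (hf : Measurable fun q : Icc (-M) M × 𝒴 => f q.1 q.2) :
    ∀ᵐ y ∂responseLaw p x, ∀ᵐ θ : Θ ∂prior, ∀ i, 0 < f (θ.1 (x i)) (y i) := by
  have : IsProbabilityMeasure (responseLaw p x) := by unfold responseLaw; infer_instance
  have hm : MeasurableSet {q : Θ × (ℕ → 𝒴) | ∀ i, 0 < f (q.1.1 (x i)) (q.2 i)} := by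
    simp only [ofPred_forall]
    refine MeasurableSet.iInter fun i => measurableSet_lt measurable_const ?_
    exact (measurable_density_eval hf (x i)).comp
      (measurable_fst.prodMk ((measurable_pi_apply i).comp measurable_snd))
  exact (Measure.ae_ae_comm hm).1 (Eventually.of_forall fun θ => h.ae_pos x fun i => θ.1 (x i))

/-! ### Exponential rates for the numerator and the denominator. -/

variable [CompactSpace X]

/-- Moments of the likelihood ratio integral over a small ball. -/
theorem RatioConditions.exists_lintegral_rpow_ratioIntegral_ball_le [IsProbabilityMeasure prior]
    (h : RatioConditions p f) (hf : Measurable fun q : Icc (-M) M × 𝒴 => f q.1 q.2)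
    (x : ℕ → X) (θstar θ₁ : Θ) {c : ℝ} (hc : 0 < c) :
    ∃ α : ℝ, 0 < α ∧ ∃ r > 0, ∀ n,
      ∫⁻ y, ratioIntegral f x θstar.1 prior y n (Metric.ball θ₁ r) ^ α ∂responseLaw p x ≤
        ENNReal.ofReal (Real.exp (α * ∑ i ∈ Finset.range n, (c - expect p (x i)
          fun y => Real.log (f (θstar.1 (x i)) y / f (θ₁.1 (x i)) y)))) := by
  obtain ⟨α, hα, hα', hE⟩ := h.exists_rpow_le_add (half_pos hc)
  obtain ⟨C, hC, hCE⟩ := h.exists_rpow_le (α := 2 * α) ⟨by positivity, hα'⟩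
  set D : ℝ := C ^ (1 / 2 : ℝ) with hD
  have hD0 : 0 < D := Real.rpow_pos_of_pos hC _
  -- Chosen so that the error `η ^ α * D` of the one-step bound is exactly `α * (c / 2)`, the other
  -- half of the slack `c`.
  set η : ℝ := (α * (c / 2) / D) ^ α⁻¹ with hη
  have hη0 : 0 < η := Real.rpow_pos_of_pos (by positivity) _
  have hηα : η ^ α * D = α * (c / 2) := by
    rw [hη, ← Real.rpow_mul (by positivity), inv_mul_cancel₀ hα.ne', Real.rpow_one]
    field_simp
  obtain ⟨r, hr, hclose⟩ := h.exists_lintegral_abs_sub_one_le hη0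
  refine ⟨α, hα, r, hr, fun n => ?_⟩
  have hmix := lintegral_rpow_mixture_prod_le (P := fun i => (p (x i)).law)
    (ν := prior.restrict (Metric.ball θ₁ r)) (α := α)
    (s := fun i (θ : Θ) y => ENNReal.ofReal (f (θ.1 (x i)) y / f (θstar.1 (x i)) y))
    (fun i => measurable_ratio hf (x i) (θstar.1 (x i)))
    (ρ := fun i => ENNReal.ofReal (Real.exp (α * (c - expect p (x i)
          fun y => Real.log (f (θstar.1 (x i)) y / f (θ₁.1 (x i)) y))))) ?_ n
  · refine hmix.trans ?_
    rw [← ENNReal.ofReal_prod_of_nonneg (fun i _ => (Real.exp_pos _).le), ← Real.exp_sum,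
      ← Finset.mul_sum]
    refine mul_le_of_le_one_right' (ENNReal.rpow_le_one ?_ hα.le)
    rw [Measure.restrict_apply_univ]
    exact prob_le_one
  intro i g hg
  refine (lintegral_rpow_mixture_le (P := (p (x i)).law)
    (ν := prior.restrict (Metric.ball θ₁ r)) hα hα'
    (u := fun (θ : Θ) y => ENNReal.ofReal (f (θ.1 (x i)) y / f (θ₁.1 (x i)) y))
    (w := fun y => ENNReal.ofReal (f (θ₁.1 (x i)) y / f (θstar.1 (x i)) y))
    (d := fun (θ : Θ) y => ENNReal.ofReal |f (θ.1 (x i)) y / f (θ₁.1 (x i)) y - 1|)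
    (measurable_ratio hf (x i) (θ₁.1 (x i)))
    (((f _).measurable.div (f _).measurable).ennreal_ofReal) ?_ ?_ ?_
    (η := ENNReal.ofReal η) ?_ hg).trans ?_
  · have hm := ((measurable_density_eval (Θ := Θ) hf (x i)).div
      ((f (θ₁.1 (x i))).measurable.comp measurable_snd)).sub_const 1
    simpa [Real.norm_eq_abs] using hm.norm.ennreal_ofReal
  · filter_upwards [h.pos (x i) (θ₁.1 (x i))] with y hy θ
    rw [← ENNReal.ofReal_mul (ratio_nonneg f _ _ y), mul_comm, div_mul_div_cancel₀ hy.ne']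
  · intro θ y
    rw [← ENNReal.ofReal_one, ← ENNReal.ofReal_add zero_le_one (abs_nonneg _)]
    refine ENNReal.ofReal_le_ofReal ?_
    linarith [le_abs_self (f (θ.1 (x i)) y / f (θ₁.1 (x i)) y - 1)]
  · refine (ae_restrict_mem Metric.isOpen_ball.measurableSet).mono fun θ hθ => ?_
    exact hclose _ _ _ ((ContinuousMap.dist_apply_le_dist (x i)).trans_lt hθ)
  · gcongr
    rw [h.lintegral_rpow ⟨hα.le, by linarith⟩, h.lintegral_rpow ⟨by positivity, hα'⟩]
    calc _ ≤ ENNReal.ofReal (expect p (x i) fun y =>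
            (f (θ₁.1 (x i)) y / f (θstar.1 (x i)) y) ^ α) +
          ENNReal.ofReal η ^ α * ENNReal.ofReal C ^ (1 / 2 : ℝ) := by
          gcongr
          exact hCE _ _ _
      _ = ENNReal.ofReal ((expect p (x i) fun y =>
            (f (θ₁.1 (x i)) y / f (θstar.1 (x i)) y) ^ α) + α * (c / 2)) := by
          rw [ENNReal.ofReal_rpow_of_nonneg hη0.le hα.le,
            ENNReal.ofReal_rpow_of_nonneg hC.le (by norm_num),
            ← ENNReal.ofReal_mul (by positivity), ← hD, hηα,
            ENNReal.ofReal_add _ (by positivity)]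
          exact integral_nonneg fun y => Real.rpow_nonneg (ratio_nonneg f _ _ y) _
      _ ≤ _ := by
          refine ENNReal.ofReal_le_ofReal ?_
          have h1 := hE (x i) (θ₁.1 (x i)) (θstar.1 (x i))
          rw [expect_log_swap] at h1
          refine le_trans ?_ (Real.add_one_le_exp _)
          linarith

/-- Away from `θstar`, the likelihood ratio integrals over small balls decrease exponentially. -/
theorem RatioConditions.exists_ball_tendsto_zero [IsProbabilityMeasure prior]
    (h : RatioConditions p f) (hf : Measurable fun q : Icc (-M) M × 𝒴 => f q.1 q.2)
    {θstar θ₁ : Θ} (hsep : UniformSeparation p f θstar.1) (hdesign : PositiveLowerFrequency x)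
    (hne : θ₁ ≠ θstar) :
    ∃ r > 0, ∃ b > 0, ∀ᵐ y ∂responseLaw p x, Tendsto (fun n : ℕ =>
      ENNReal.ofReal (Real.exp (b * n)) *
        ratioIntegral f x θstar.1 prior y n (Metric.ball θ₁ r)) atTop (𝓝 0) := by
  obtain ⟨c, hc, hsum⟩ := h.exists_le_sum_expect_log (θ₁ := θ₁.1) hsep hdesign
    fun heq => hne (Subtype.ext heq)
  obtain ⟨α, hα, r, hr, hmom⟩ := h.exists_lintegral_rpow_ratioIntegral_ball_le (prior := prior)
    hf x θstar θ₁ (half_pos hc)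
  -- The moment bound with slack `c / 2` is at most `exp (-α * (c / 2) * n)`; the factor `exp (c / 4
  -- * n)` to the power `α` uses half of this decay.
  refine ⟨r, hr, c / 4, by positivity, ?_⟩
  have hI : ∀ n : ℕ, Measurable fun y =>
      ratioIntegral f x θstar.1 prior y n (Metric.ball θ₁ r) := fun n =>
    measurable_ratioIntegral hf θstar.1 n _
  have hlim := ae_tendsto_zero_of_lintegral_le_exp (P := responseLaw p x)
    (Z := fun n y => (ENNReal.ofReal (Real.exp (c / 4 * n)) *
      ratioIntegral f x θstar.1 prior y n (Metric.ball θ₁ r)) ^ α)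
    (fun n => ((hI n).const_mul _).pow_const α) ENNReal.one_ne_top (β := α * (c / 4))
    (by positivity) ?_
  · filter_upwards [hlim] with y hy
    have := (ENNReal.continuous_rpow_const (y := α⁻¹)).continuousAt.tendsto.comp hy
    rw [ENNReal.zero_rpow_of_pos (inv_pos.2 hα)] at this
    refine this.congr fun n => ?_
    rw [Function.comp_apply, ← ENNReal.rpow_mul, mul_inv_cancel₀ hα.ne', ENNReal.rpow_one]
  filter_upwards [hsum] with n hn
  simp only [ENNReal.mul_rpow_of_nonneg _ _ hα.le]
  rw [lintegral_const_mul _ ((hI n).pow_const α)]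
  refine (mul_le_mul_right (hmom n) _).trans ?_
  rw [one_mul, ENNReal.ofReal_rpow_of_nonneg (Real.exp_pos _).le hα.le, ← Real.exp_mul,
    ← ENNReal.ofReal_mul (Real.exp_pos _).le, ← Real.exp_add]
  refine ENNReal.ofReal_le_ofReal (Real.exp_le_exp.2 ?_)
  rw [Finset.sum_sub_distrib, Finset.sum_const, Finset.card_range, nsmul_eq_mul]
  have := mul_le_mul_of_nonneg_left hn hα.le
  linarith

/-- By Tonelli the mean of the integral is at most `C ^ n`, where `C` bounds all first moments of
the ratios. -/
theorem RatioConditions.ae_ratioIntegral_ne_top [IsProbabilityMeasure prior]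
    (h : RatioConditions p f) (hf : Measurable fun q : Icc (-M) M × 𝒴 => f q.1 q.2)
    (θstar : C(X, Icc (-M) M)) :
    ∀ᵐ y ∂responseLaw p x, ∀ n, ratioIntegral f x θstar prior y n univ ≠ ∞ := by
  obtain ⟨C, -, hC⟩ := h.exists_rpow_le (α := 1) (by simp)
  refine ae_all_iff.2 fun n => ?_
  have hle := lintegral_mixture_prod_le (P := fun i => (p (x i)).law)
    (ν := prior.restrict univ)
    (s := fun i (θ : Θ) y => ENNReal.ofReal (f (θ.1 (x i)) y / f (θstar (x i)) y))
    (fun i => measurable_ratio hf (x i) (θstar (x i)))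
    (ρ := fun _ => ENNReal.ofReal C) (fun i => Eventually.of_forall fun θ => by
      rw [h.lintegral_ratio]
      exact ENNReal.ofReal_le_ofReal (by simpa using hC (x i) (θ.1 (x i)) (θstar (x i)))) n
  have hfin : ∫⁻ y, ratioIntegral f x θstar prior y n univ ∂responseLaw p x ≠ ∞ :=
    ne_top_of_le_ne_top (by simp) hle
  exact (ae_lt_top (measurable_ratioIntegral hf θstar n univ) hfin).mono fun y hy => hy.ne

/-- Restrict the denominator to a ball around `θstar` on which the reciprocal ratios have mean below
`exp b`, and pass to reciprocals by `inv_lintegral_le`. Prior support makes the ball's mass, hence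
`C`, usable. -/
theorem RatioConditions.exists_lintegral_inv_ratioIntegral_le [IsProbabilityMeasure prior]
    (h : RatioConditions p f) (hf : Measurable fun q : Icc (-M) M × 𝒴 => f q.1 q.2)
    {θstar : Θ} (hsupp : ∀ r : ℝ, 0 < r → 0 < prior (Metric.ball θstar r))
    {b : ℝ} (hb : 0 < b) : ∃ C : ℝ≥0∞, C ≠ ∞ ∧ ∀ n : ℕ,
      ∫⁻ y, (ratioIntegral f x θstar.1 prior y n univ)⁻¹ ∂responseLaw p x ≤
        C * ENNReal.ofReal (Real.exp (b * n)) := by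
  obtain ⟨r, hr, hclose⟩ := h.exists_ratio_le (Real.one_lt_exp_iff.2 hb)
  set B := Metric.ball θstar r with hB
  have hB0 : prior.restrict B univ ≠ 0 := by
    rw [Measure.restrict_apply_univ]; exact (hsupp r hr).ne'
  refine ⟨(prior.restrict B univ)⁻¹ ^ 2, by simpa using hB0, fun n => ?_⟩
  have hle := lintegral_mixture_prod_le (P := fun i => (p (x i)).law)
    (ν := prior.restrict B)
    (s := fun i (θ : Θ) y => ENNReal.ofReal (f (θstar.1 (x i)) y / f (θ.1 (x i)) y))
    (fun i => measurable_ratio' hf (x i) (θstar.1 (x i)))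
    (ρ := fun _ => ENNReal.ofReal (Real.exp b)) (fun i =>
      (ae_restrict_mem Metric.isOpen_ball.measurableSet).mono fun θ hθ => by
      rw [h.lintegral_ratio]
      refine ENNReal.ofReal_le_ofReal (hclose _ _ _ ?_).le
      rw [dist_comm]
      exact (ContinuousMap.dist_apply_le_dist (x i)).trans_lt hθ) n
  have hpt : ∀ᵐ y ∂responseLaw p x, (ratioIntegral f x θstar.1 prior y n univ)⁻¹ ≤
      (prior.restrict B univ)⁻¹ ^ 2 * ∫⁻ θ in B, ∏ i ∈ Finset.range n,
        ENNReal.ofReal (f (θstar.1 (x i)) (y i) / f (θ.1 (x i)) (y i)) ∂prior := by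
    filter_upwards [h.ae_ae_pos (x := x) (prior := prior) hf,
      h.ae_pos x fun i => θstar.1 (x i)] with y hy hys
    refine le_trans (ENNReal.inv_le_inv.2 (lintegral_mono_set (subset_univ B)))
      (inv_lintegral_le hB0 ?_ ?_ ?_)
    · exact Finset.measurable_prod _ fun i _ => (measurable_ratio hf (x i) (θstar.1 (x i))).comp
        (measurable_id.prodMk measurable_const)
    · exact Finset.measurable_prod _ fun i _ => (measurable_ratio' hf (x i) (θstar.1 (x i))).comp
        (measurable_id.prodMk measurable_const)
    · filter_upwards [ae_restrict_of_ae hy] with θ hθ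
      rw [← Finset.prod_mul_distrib]
      refine (Finset.prod_eq_one fun i _ => ?_).ge
      rw [← ENNReal.ofReal_mul (ratio_nonneg f _ _ _), div_mul_div_cancel₀ (hys i).ne',
        div_self (hθ i).ne', ENNReal.ofReal_one]
  calc _ ≤ _ := lintegral_mono_ae hpt
    _ = (prior.restrict B univ)⁻¹ ^ 2 * ∫⁻ y, ∫⁻ θ in B, ∏ i ∈ Finset.range n,
        ENNReal.ofReal (f (θstar.1 (x i)) (y i) / f (θ.1 (x i)) (y i)) ∂prior
          ∂responseLaw p x := lintegral_const_mul' _ _ (by simpa using hB0)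
    _ ≤ _ := by
      gcongr
      refine hle.trans ?_
      rw [Finset.prod_const, Finset.card_range, ← ENNReal.ofReal_pow (Real.exp_pos b).le,
        ← Real.exp_nat_mul, mul_comm b]
      refine mul_le_of_le_one_right' ?_
      rw [Measure.restrict_apply_univ]
      exact prob_le_one

/-- A reciprocal with finite mean is almost surely finite; any rate serves, here 1. -/
theorem RatioConditions.ae_ratioIntegral_ne_zero [IsProbabilityMeasure prior]
    (h : RatioConditions p f) (hf : Measurable fun q : Icc (-M) M × 𝒴 => f q.1 q.2)
    {θstar : Θ} (hsupp : ∀ r : ℝ, 0 < r → 0 < prior (Metric.ball θstar r)) :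
    ∀ᵐ y ∂responseLaw p x, ∀ n, ratioIntegral f x θstar.1 prior y n univ ≠ 0 := by
  obtain ⟨C, hC, hle⟩ := h.exists_lintegral_inv_ratioIntegral_le (x := x) hf hsupp zero_lt_one
  refine ae_all_iff.2 fun n => ?_
  have hfin := ne_top_of_le_ne_top (ENNReal.mul_ne_top hC ENNReal.ofReal_ne_top) (hle n)
  filter_upwards [ae_lt_top (measurable_ratioIntegral hf θstar.1 n univ).inv hfin] with y hy
  exact ENNReal.inv_ne_top.1 hy.ne

/-- The denominator of the posterior decreases more slowly than every exponential. -/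
theorem RatioConditions.ae_tendsto_inv_ratioIntegral [IsProbabilityMeasure prior]
    (h : RatioConditions p f) (hf : Measurable fun q : Icc (-M) M × 𝒴 => f q.1 q.2)
    {θstar : Θ} (hsupp : ∀ r : ℝ, 0 < r → 0 < prior (Metric.ball θstar r))
    {b : ℝ} (hb : 0 < b) : ∀ᵐ y ∂responseLaw p x, Tendsto (fun n : ℕ =>
      ENNReal.ofReal (Real.exp (-b * n)) * (ratioIntegral f x θstar.1 prior y n univ)⁻¹)
      atTop (𝓝 0) := by
  obtain ⟨C, hC, hle⟩ := h.exists_lintegral_inv_ratioIntegral_le (x := x) hf hsupp (half_pos hb)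
  refine ae_tendsto_zero_of_lintegral_le_exp
    (fun n => (measurable_ratioIntegral hf θstar.1 n univ).inv.const_mul _) hC (half_pos hb)
    (Eventually.of_forall fun n => ?_)
  rw [lintegral_const_mul _ (f := fun y => (ratioIntegral f x θstar.1 prior y n univ)⁻¹)
    (measurable_ratioIntegral hf θstar.1 n univ).inv]
  refine (mul_le_mul_right (hle n) _).trans ?_
  rw [mul_left_comm, ← ENNReal.ofReal_mul (Real.exp_pos _).le, ← Real.exp_add]
  gcongr C * ENNReal.ofReal (Real.exp ?_)
  linarith

/-- Every parameter other than `θstar` has a neighbourhood whose posterior mass vanishes. -/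
theorem RatioConditions.exists_ball_tendsto_posterior [IsProbabilityMeasure prior]
    (h : RatioConditions p f) (hf : Measurable fun q : Icc (-M) M × 𝒴 => f q.1 q.2)
    {θstar θ₁ : Θ} (hsupp : ∀ r : ℝ, 0 < r → 0 < prior (Metric.ball θstar r))
    (hsep : UniformSeparation p f θstar.1) (hdesign : PositiveLowerFrequency x)
    (hne : θ₁ ≠ θstar) :
    ∃ r > 0, ∀ᵐ y ∂responseLaw p x, Tendsto (fun n : ℕ =>
        posterior f x θstar.1 prior y n (Metric.ball θ₁ r)) atTop (𝓝 0) := by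
  obtain ⟨r, hr, b, hb, hnum⟩ := h.exists_ball_tendsto_zero (prior := prior) hf hsep hdesign hne
  refine ⟨r, hr, ?_⟩
  filter_upwards [hnum, h.ae_tendsto_inv_ratioIntegral (x := x) hf hsupp hb] with y h1 h2
  have h3 := ENNReal.Tendsto.mul h1 (Or.inr ENNReal.zero_ne_top) h2 (Or.inr ENNReal.zero_ne_top)
  rw [mul_zero] at h3
  refine h3.congr fun n => ?_
  -- The exponential weights on numerator and reciprocal denominator cancel, leaving the posterior.
  rw [mul_mul_mul_comm, ← ENNReal.ofReal_mul (Real.exp_pos _).le, ← Real.exp_add, posterior,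
    div_eq_mul_inv]
  simp

end Posterior

end Misspecified

/-! ### Consistency by compactness. -/

theorem theorem2
    {X : Type*} [MetricSpace X] [CompactSpace X]
    {𝒴 : Type*} [MeasurableSpace 𝒴] {μ : Measure 𝒴} {M : ℝ}
    -- the true densities and the specified family of densities
    (p : X → Misspecified.ProbDensity μ)
    (f : Icc (-M) M → Misspecified.ProbDensity μ)
    (hf : Measurable fun q : Icc (-M) M × 𝒴 => f q.1 q.2)
    -- the parameter space (with the sup metric) and the prior
    (Θ : Set C(X, Icc (-M) M)) (hΘ : IsCompact Θ)
    [MeasurableSpace Θ] [BorelSpace Θ]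
    (prior : Measure Θ) [IsProbabilityMeasure prior]
    -- the design points
    (x : ℕ → X)
    -- the pointwise minimiser, which lies in the support of the prior
    (θstar : Θ)
    (hmin : Misspecified.IsPointwiseKLMinimizer p f θstar.1)
    (hsupp : ∀ r : ℝ, 0 < r → 0 < prior (Metric.ball θstar r))
    (hratio : Misspecified.RatioConditions p f)
    (hsep : Misspecified.UniformSeparation p f θstar.1)
    (hdesign : Misspecified.PositiveLowerFrequency x)
    (ε : ℝ) (hε : 0 < ε) :
    ∀ᵐ y ∂(Misspecified.responseLaw p x),
      (∀ n : ℕ, Misspecified.ratioIntegral f x θstar.1 prior y n univ ≠ 0 ∧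
        Misspecified.ratioIntegral f x θstar.1 prior y n univ ≠ ∞) ∧
      Tendsto
        (fun n : ℕ => Misspecified.posterior f x θstar.1 prior y n
          {θ : Θ | ε < ⨆ z : X, |(θ.1 z : ℝ) - (θstar.1 z : ℝ)|})
        atTop (𝓝 0) := by
  have hne : Nonempty X := ⟨x 0⟩
  have hcompact : CompactSpace Θ := isCompact_iff_compactSpace.1 hΘ
  have hclosed : IsClosed {θ : Θ | ε ≤ dist θ θstar} :=
    isClosed_le continuous_const (by fun_prop)
  have hfar : ∀ᵐ y ∂Misspecified.responseLaw p x, Tendsto (fun n : ℕ =>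
      Misspecified.posterior f x θstar.1 prior y n {θ : Θ | ε ≤ dist θ θstar}) atTop (𝓝 0) := by
    refine hclosed.isCompact.induction_on (p := fun A => ∀ᵐ y ∂Misspecified.responseLaw p x,
      Tendsto (fun n : ℕ => Misspecified.posterior f x θstar.1 prior y n A) atTop (𝓝 0)) ?_ ?_ ?_ ?_
    · simp [Misspecified.posterior, Misspecified.ratioIntegral]
    · exact fun A B hAB hB => hB.mono fun y hy => Misspecified.tendsto_posterior_mono hAB hy
    · intro A B hA hB
      filter_upwards [hA, hB] with y h1 h2 using Misspecified.tendsto_posterior_union h1 h2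
    · intro θ₁ hθ₁
      have hne₁ : θ₁ ≠ θstar := dist_pos.1 (hε.trans_le hθ₁)
      obtain ⟨r, hr, H⟩ := hratio.exists_ball_tendsto_posterior hf hsupp hsep hdesign hne₁
      exact ⟨_, mem_nhdsWithin_of_mem_nhds (Metric.ball_mem_nhds θ₁ hr), H⟩
  filter_upwards [hratio.ae_ratioIntegral_ne_top (x := x) (prior := prior) hf θstar.1,
    hratio.ae_ratioIntegral_ne_zero (x := x) (prior := prior) hf hsupp, hfar] with y h1 h2 h3
  refine ⟨fun n => ⟨h2 n, h1 n⟩, Misspecified.tendsto_posterior_mono (fun θ hθ => ?_) h3⟩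
  -- The supremum is at most the sup distance, so the open condition `ε < ⨆` lies in the closed,
  -- hence compact, set `ε ≤ dist`. Nonemptiness of `X` is needed for `ciSup_le`.
  exact (lt_of_lt_of_le hθ (ciSup_le fun z => ContinuousMap.dist_apply_le_dist (f := θ.1) z)).le
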